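/- Let $R$ be an associative ring with unit (not necessarily commutative), let $n \ge 0$ be an integer, and suppose that $R$ is left $n$-perfect, i.e. every flat left $R$-module has projective dimension at most $n$. Then every Gorenstein flat left $R$-module $G$ has $\mathcal{PGF}$ dimension at most $n$. Here a left $R$-module is Gorenstein flat if it is a cycle $Z_j(F)$ of an acyclic ($\mathbb{Z}$-indexed) complex $F$ of flat left $R$-modules such that $I \otimes_R F$ is acyclic for every injective right $R$-module $I$. A left $R$-module is in $\mathcal{PGF}$ (projectively coresolved Gorenstein flat) if it is a cycle of an acyclic ($\mathbb{Z}$-indexed) complex $P$ of projective left $R$-modules such that $I \otimes_R P$ is acyclic for every injective right $R$-module $I$. The $\mathcal{PGF}$ dimension of $M$ is the least integer $m \ge 0$ for which there is an exact sequence $0 \to G_m \to \cdots \to G_1 \to G_0 \to M \to 0$ with all $G_i \in \mathcal{PGF}$ (and $\infty$ if there is none). -/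

import Mathlib

open CategoryTheory
open scoped TensorProduct

universe u v w

namespace PGF

section Tensor

variable (R : Type u) [Ring R]

/-- The subgroup of `I ⊗[ℤ] M` generated by the elements `(i r) ⊗ m - i ⊗ (r m)`, for a right
`R`-module `I` (that is, a module over `Rᵐᵒᵖ`, with `i r = op r • i`) and a left `R`-module `M`. -/
def tensorRelations (I : Type w) [AddCommGroup I] [Module Rᵐᵒᵖ I]
    (M : Type v) [AddCommGroup M] [Module R M] : AddSubgroup (I ⊗[ℤ] M) :=
  AddSubgroup.closure {x | ∃ (i : I) (r : R) (m : M),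
    x = (MulOpposite.op r • i) ⊗ₜ[ℤ] m - i ⊗ₜ[ℤ] (r • m)}

/-- The abelian group `I ⊗_R M` for a right module `I` and a left module `M` over a ring `R`
that need not be commutative. -/
abbrev Tensor (I : Type w) [AddCommGroup I] [Module Rᵐᵒᵖ I]
    (M : Type v) [AddCommGroup M] [Module R M] : Type (max w v) :=
  (I ⊗[ℤ] M) ⧸ tensorRelations R I M

variable {R}

/-- The elementary tensor `i ⊗ m` in `I ⊗_R M`. -/
def Tensor.tmul {I : Type w} [AddCommGroup I] [Module Rᵐᵒᵖ I]
    {M : Type v} [AddCommGroup M] [Module R M] (i : I) (m : M) : Tensor R I M :=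
  QuotientAddGroup.mk' (tensorRelations R I M) (i ⊗ₜ[ℤ] m)

/-- Homomorphisms out of `I ⊗_R M` that agree on elementary tensors are equal. -/
theorem Tensor.hom_ext {I : Type w} [AddCommGroup I] [Module Rᵐᵒᵖ I]
    {M : Type v} [AddCommGroup M] [Module R M] {A : Type*} [AddCommGroup A]
    {f g : Tensor R I M →+ A}
    (h : ∀ (i : I) (m : M), f (Tensor.tmul i m) = g (Tensor.tmul i m)) : f = g := by
  refine QuotientAddGroup.addMonoidHom_ext _ (AddMonoidHom.ext fun x => ?_)
  induction x using TensorProduct.induction_on with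
  | zero => simp only [map_zero]
  | tmul i m => exact h i m
  | add x y hx hy => simp only [map_add, hx, hy]

/-- The homomorphism `f ⊗ g : I ⊗_R M → J ⊗_R N`. -/
noncomputable def Tensor.map
    {I J : Type w} [AddCommGroup I] [Module Rᵐᵒᵖ I] [AddCommGroup J] [Module Rᵐᵒᵖ J]
    {M N : Type v} [AddCommGroup M] [Module R M] [AddCommGroup N] [Module R N]
    (f : I →ₗ[Rᵐᵒᵖ] J) (g : M →ₗ[R] N) : Tensor R I M →+ Tensor R J N :=
  QuotientAddGroup.map (tensorRelations R I M) (tensorRelations R J N)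
    (TensorProduct.map f.toAddMonoidHom.toIntLinearMap
      g.toAddMonoidHom.toIntLinearMap).toAddMonoidHom (by
      rw [tensorRelations, AddSubgroup.closure_le]
      rintro _ ⟨i, r, m, rfl⟩
      refine AddSubgroup.subset_closure ⟨f i, r, g m, ?_⟩
      rw [map_sub, ← f.map_smul, ← g.map_smul]
      rfl)

/-- The functor `I ⊗_R -` from left `R`-modules to abelian groups, for a right `R`-module `I`. -/
noncomputable def tensorLeft (I : ModuleCat.{v} Rᵐᵒᵖ) : ModuleCat.{v} R ⥤ AddCommGrpCat.{v} where
  obj M := AddCommGrpCat.of (Tensor R I M)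
  map g := AddCommGrpCat.ofHom (Tensor.map LinearMap.id g.hom)
  map_id _ := AddCommGrpCat.hom_ext (Tensor.hom_ext fun _ _ => rfl)
  map_comp _ _ := AddCommGrpCat.hom_ext (Tensor.hom_ext fun _ _ => rfl)

instance tensorLeft_additive (I : ModuleCat.{v} Rᵐᵒᵖ) : (tensorLeft (R := R) I).Additive where
  map_add {_ N g h} := AddCommGrpCat.hom_ext (Tensor.hom_ext fun i m =>
    congrArg (QuotientAddGroup.mk' (tensorRelations R I N))
      (TensorProduct.tmul_add i (g.hom m) (h.hom m)))

end Tensor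

section Classes

variable {R : Type u} [Ring R]

/-- A left `R`-module `M` is flat if `- ⊗_R M` preserves injectivity of homomorphisms of right
`R`-modules. -/
def IsFlat (M : ModuleCat.{v} R) : Prop :=
  ∀ (A B : ModuleCat.{v} Rᵐᵒᵖ) (f : A →ₗ[Rᵐᵒᵖ] B), Function.Injective f →
    Function.Injective (Tensor.map f (LinearMap.id : M →ₗ[R] M))

/-- A complex of left `R`-modules stays acyclic when it is tensored with any injective right
`R`-module. -/
def InjTensorAcyclic (X : ChainComplex (ModuleCat.{v} R) ℤ) : Prop :=
  ∀ I : ModuleCat.{v} Rᵐᵒᵖ, Module.Injective Rᵐᵒᵖ I →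
    (((tensorLeft I).mapHomologicalComplex (ComplexShape.down ℤ)).obj X).Acyclic

/-- An F-totally acyclic complex: an acyclic complex of flat left modules that stays acyclic when
tensored with any injective right module. -/
structure IsFTotallyAcyclic (X : ChainComplex (ModuleCat.{v} R) ℤ) : Prop where
  acyclic : X.Acyclic
  flat : ∀ j, IsFlat (X.X j)
  tensor : InjTensorAcyclic X

/-- A Gorenstein flat module: a cycle of an F-totally acyclic complex. -/
def IsGorensteinFlat (M : ModuleCat.{v} R) : Prop :=
  ∃ X : ChainComplex (ModuleCat.{v} R) ℤ, IsFTotallyAcyclic X ∧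
    ∃ j : ℤ, Nonempty (M ≅ X.cycles j)

/-- A projectively coresolved Gorenstein flat module: a cycle of an acyclic complex of projective
modules that stays acyclic when tensored with any injective right module. -/
def IsPGF (M : ModuleCat.{v} R) : Prop :=
  ∃ X : ChainComplex (ModuleCat.{v} R) ℤ, X.Acyclic ∧ (∀ j, Module.Projective R (X.X j)) ∧
    InjTensorAcyclic X ∧ ∃ j : ℤ, Nonempty (M ≅ X.cycles j)

/-- There is an exact sequence `0 → G_n → ⋯ → G_1 → G_0 → M → 0` with every `G_i` in PGF.
It is encoded as an exact complex `E` with `E_0 = M` and `E_{i+1} = G_i`; exactness of the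
complex at `0` says that `G_0 → M` is surjective. -/
def HasPGFResolution (M : ModuleCat.{v} R) (n : ℕ) : Prop :=
  ∃ E : ChainComplex (ModuleCat.{v} R) ℕ, E.Acyclic ∧ Nonempty (E.X 0 ≅ M) ∧
    (∀ i ≤ n, IsPGF (E.X (i + 1))) ∧ (∀ i > n, Limits.IsZero (E.X (i + 1)))

/-- The PGF dimension of a module: the least length of a resolution by PGF modules, and `⊤` if
there is no finite one. -/
noncomputable def pgfDimension (M : ModuleCat.{v} R) : ℕ∞ :=
  ⨅ (n : ℕ) (_ : HasPGFResolution M n), (n : ℕ∞)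

end Classes

/-- A ring is left `n`-perfect if every flat left module has projective dimension at most `n`. -/
def IsLeftNPerfect (R : Type u) [Ring R] (n : ℕ) : Prop :=
  ∀ M : ModuleCat.{v} R, IsFlat M → HasProjectiveDimensionLE M n

end PGF

/-! Let `G` be a cycle of an F-totally acyclic complex `X`. Over a left `n`-perfect ring the terms
of `X` have projective dimension at most `n`, and the proof is dimension shifting on whole
complexes, by induction on `n`. A sum of disks on projectives is contractible and maps onto `X`. Its
cycles are PGF, and the kernel is again F-totally acyclic, with terms of projective dimension one
less. Taking cycles gives a short exact sequence, so a resolution for the kernel extends by one step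
(`HasPGFResolution.succ`). When `n = 0` the terms are projective and the cycles are PGF by
definition. The delicate point is that the kernel stays acyclic under `I ⊗_R -`: flatness of the
terms of `X` keeps the tensored sequence exact (`IsFlat.map_injective`). -/

namespace PGF

/-! ### Tensor products over a noncommutative ring: right exactness and projective modules. -/

section TensorFacts

variable {R : Type u} [Ring R]
variable {I J L : Type w} [AddCommGroup I] [Module Rᵐᵒᵖ I] [AddCommGroup J] [Module Rᵐᵒᵖ J]
  [AddCommGroup L] [Module Rᵐᵒᵖ L]
variable {M N K : Type v} [AddCommGroup M] [Module R M] [AddCommGroup N] [Module R N]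
  [AddCommGroup K] [Module R K]

theorem Tensor.induction {p : Tensor R I M → Prop} (zero : p 0)
    (tmul : ∀ (i : I) (m : M), p (Tensor.tmul i m))
    (add : ∀ x y, p x → p y → p (x + y)) (x : Tensor R I M) : p x := by
  obtain ⟨x, rfl⟩ := QuotientAddGroup.mk'_surjective _ x
  induction x using TensorProduct.induction_on with
  | zero => simpa only [map_zero] using zero
  | tmul i m => exact tmul i m
  | add x y hx hy => simpa only [map_add] using add _ _ hx hy

/-- The homomorphism out of `I ⊗_R M` induced by a balanced biadditive map. -/
noncomputable def Tensor.lift {A : Type*} [AddCommGroup A] (f : I →+ M →+ A)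
    (hf : ∀ (i : I) (r : R) (m : M), f (MulOpposite.op r • i) m = f i (r • m)) :
    Tensor R I M →+ A :=
  QuotientAddGroup.lift (tensorRelations R I M)
    (TensorProduct.liftAddHom f fun k i m => by simp) (by
      rw [tensorRelations, AddSubgroup.closure_le]
      rintro _ ⟨i, r, m, rfl⟩
      simp [hf])

@[simp]
theorem Tensor.map_tmul (f : I →ₗ[Rᵐᵒᵖ] J) (g : M →ₗ[R] N) (i : I) (m : M) :
    Tensor.map f g (Tensor.tmul i m) = Tensor.tmul (f i) (g m) :=
  rfl

theorem Tensor.tmul_add (i : I) (m m' : M) :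
    Tensor.tmul (R := R) i (m + m') = Tensor.tmul i m + Tensor.tmul i m' :=
  congrArg (QuotientAddGroup.mk' (tensorRelations R I M)) (TensorProduct.tmul_add i m m')

theorem Tensor.add_tmul (i i' : I) (m : M) :
    Tensor.tmul (R := R) (i + i') m = Tensor.tmul i m + Tensor.tmul i' m :=
  congrArg (QuotientAddGroup.mk' (tensorRelations R I M)) (TensorProduct.add_tmul i i' m)

theorem Tensor.smul_tmul (r : R) (i : I) (m : M) :
    Tensor.tmul (MulOpposite.op r • i) m = Tensor.tmul (R := R) i (r • m) := by
  have h : (MulOpposite.op r • i) ⊗ₜ[ℤ] m - i ⊗ₜ[ℤ] (r • m) ∈ tensorRelations R I M :=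
    AddSubgroup.subset_closure ⟨i, r, m, rfl⟩
  have h' := (QuotientAddGroup.eq_zero_iff _).2 h
  rw [← sub_eq_zero]
  exact h'

/-- Elementary tensors as a biadditive map. -/
noncomputable def Tensor.mk : I →+ M →+ Tensor R I M :=
  AddMonoidHom.mk' (fun i => AddMonoidHom.mk' (fun m => Tensor.tmul i m) (Tensor.tmul_add i))
    fun i i' => AddMonoidHom.ext fun m => Tensor.add_tmul i i' m

@[simp]
theorem Tensor.mk_apply (i : I) (m : M) : Tensor.mk (R := R) i m = Tensor.tmul i m :=
  rfl

theorem Tensor.map_map (f : I →ₗ[Rᵐᵒᵖ] J) (f' : J →ₗ[Rᵐᵒᵖ] L) (g : M →ₗ[R] N) (g' : N →ₗ[R] K)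
    (x : Tensor R I M) :
    Tensor.map f' g' (Tensor.map f g x) = Tensor.map (f' ∘ₗ f) (g' ∘ₗ g) x := by
  induction x using Tensor.induction with
  | zero => simp only [map_zero]
  | tmul i m => rfl
  | add x y hx hy => simp only [map_add, hx, hy]

theorem Tensor.map_surjective {f : I →ₗ[Rᵐᵒᵖ] J} {g : M →ₗ[R] N}
    (hf : Function.Surjective f) (hg : Function.Surjective g) :
    Function.Surjective (Tensor.map f g) := by
  intro y
  induction y using Tensor.induction with
  | zero => exact ⟨0, map_zero _⟩
  | tmul j n =>
    obtain ⟨i, rfl⟩ := hf j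
    obtain ⟨m, rfl⟩ := hg n
    exact ⟨Tensor.tmul i m, rfl⟩
  | add x y hx hy =>
    obtain ⟨a, rfl⟩ := hx
    obtain ⟨b, rfl⟩ := hy
    exact ⟨a + b, map_add _ _ _⟩

/-- Relations lift along surjections. -/
theorem tensorRelations_le_map {f : I →ₗ[Rᵐᵒᵖ] J} {g : M →ₗ[R] N}
    (hf : Function.Surjective f) (hg : Function.Surjective g) :
    tensorRelations R J N ≤ (tensorRelations R I M).map
      (TensorProduct.map f.toAddMonoidHom.toIntLinearMap
        g.toAddMonoidHom.toIntLinearMap).toAddMonoidHom := by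
  rw [tensorRelations, AddSubgroup.closure_le]
  rintro _ ⟨j, r, n, rfl⟩
  obtain ⟨i, rfl⟩ := hf j
  obtain ⟨m, rfl⟩ := hg n
  refine ⟨_, AddSubgroup.subset_closure ⟨i, r, m, rfl⟩, ?_⟩
  simp

/-- An element killed by a tensor product of surjections lifts to an element of the tensor
product over `ℤ` killed by the same surjections. -/
theorem Tensor.exists_lift_of_map_eq_zero {f : I →ₗ[Rᵐᵒᵖ] J} {g : M →ₗ[R] N}
    (hf : Function.Surjective f) (hg : Function.Surjective g) {x : Tensor R I M}
    (hx : Tensor.map f g x = 0) :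
    ∃ z : I ⊗[ℤ] M, TensorProduct.map f.toAddMonoidHom.toIntLinearMap
      g.toAddMonoidHom.toIntLinearMap z = 0 ∧ QuotientAddGroup.mk' (tensorRelations R I M) z = x := by
  obtain ⟨x, rfl⟩ := QuotientAddGroup.mk'_surjective _ x
  have hx' := (QuotientAddGroup.eq_zero_iff _).1 hx
  obtain ⟨y, hy, hyx⟩ := tensorRelations_le_map hf hg hx'
  refine ⟨x - y, ?_, ?_⟩
  · rw [map_sub, sub_eq_zero]
    exact hyx.symm
  · rw [map_sub, sub_eq_self]
    exact (QuotientAddGroup.eq_zero_iff _).2 hy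

/-- `I ⊗_R -` is right exact. -/
theorem Tensor.exact_map_right {f : M →ₗ[R] N} {g : N →ₗ[R] K} (hfg : Function.Exact f g)
    (hg : Function.Surjective g) :
    Function.Exact (Tensor.map (LinearMap.id : I →ₗ[Rᵐᵒᵖ] I) f)
      (Tensor.map (LinearMap.id : I →ₗ[Rᵐᵒᵖ] I) g) := by
  intro x
  constructor
  · intro hx
    obtain ⟨z, hz, rfl⟩ := Tensor.exists_lift_of_map_eq_zero Function.surjective_id hg hx
    obtain ⟨y, rfl⟩ := (lTensor_exact I (f := f.toAddMonoidHom.toIntLinearMap)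
      (g := g.toAddMonoidHom.toIntLinearMap) hfg hg z).1 hz
    exact ⟨QuotientAddGroup.mk' _ y, rfl⟩
  · rintro ⟨y, rfl⟩
    rw [Tensor.map_map, hfg.linearMap_comp_eq_zero]
    induction y using Tensor.induction with
    | zero => simp only [map_zero]
    | tmul i m => exact map_zero (Tensor.mk (R := R) i)
    | add x y hx hy => simp only [map_add, hx, hy, add_zero]

/-- `- ⊗_R M` is right exact. -/
theorem Tensor.exact_map_left {f : I →ₗ[Rᵐᵒᵖ] J} {g : J →ₗ[Rᵐᵒᵖ] L} (hfg : Function.Exact f g)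
    (hg : Function.Surjective g) :
    Function.Exact (Tensor.map f (LinearMap.id : M →ₗ[R] M))
      (Tensor.map g (LinearMap.id : M →ₗ[R] M)) := by
  intro x
  constructor
  · intro hx
    obtain ⟨z, hz, rfl⟩ := Tensor.exists_lift_of_map_eq_zero hg Function.surjective_id hx
    obtain ⟨y, rfl⟩ := (rTensor_exact M (f := f.toAddMonoidHom.toIntLinearMap)
      (g := g.toAddMonoidHom.toIntLinearMap) hfg hg z).1 hz
    exact ⟨QuotientAddGroup.mk' _ y, rfl⟩
  · rintro ⟨y, rfl⟩
    rw [Tensor.map_map, hfg.linearMap_comp_eq_zero]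
    induction y using Tensor.induction with
    | zero => simp only [map_zero]
    | tmul i m => exact DFunLike.congr_fun (map_zero (Tensor.mk (R := R))) m
    | add x y hx hy => simp only [map_add, hx, hy, add_zero]

/-- Contraction `Q ⊗_R M → M` along a linear form on the right module `Q`. -/
noncomputable def Tensor.contractLeft (f : I →ₗ[Rᵐᵒᵖ] Rᵐᵒᵖ) : Tensor R I M →+ M :=
  Tensor.lift
    (AddMonoidHom.mk' (fun i => DistribSMul.toAddMonoidHom M (f i).unop) fun i i' =>
      AddMonoidHom.ext fun m => by simp [add_smul])
    fun i r m => by simp [mul_smul]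

@[simp]
theorem Tensor.contractLeft_tmul (f : I →ₗ[Rᵐᵒᵖ] Rᵐᵒᵖ) (i : I) (m : M) :
    Tensor.contractLeft f (Tensor.tmul i m) = (f i).unop • m :=
  rfl

/-- Contraction `I ⊗_R P → I` along a linear form on the left module `P`. -/
noncomputable def Tensor.contractRight (f : M →ₗ[R] R) : Tensor R I M →+ I :=
  Tensor.lift
    (AddMonoidHom.mk' (fun i => AddMonoidHom.mk' (fun m => MulOpposite.op (f m) • i)
      fun m m' => by simp [add_smul]) fun i i' => AddMonoidHom.ext fun m => by simp)
    fun i r m => by simp [mul_smul]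

@[simp]
theorem Tensor.contractRight_tmul (f : M →ₗ[R] R) (i : I) (m : M) :
    Tensor.contractRight f (Tensor.tmul i m) = MulOpposite.op (f m) • i :=
  rfl

/-- This naturality reduces injectivity of `I ⊗ g`, for projective `I`, to injectivity of `g`. -/
theorem Tensor.contractLeft_map (f : I →ₗ[Rᵐᵒᵖ] Rᵐᵒᵖ) (g : M →ₗ[R] N) (x : Tensor R I M) :
    Tensor.contractLeft f (Tensor.map LinearMap.id g x) = g (Tensor.contractLeft f x) := by
  induction x using Tensor.induction with
  | zero => simp only [map_zero]
  | tmul i m => simp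
  | add x y hx hy => simp only [map_add, hx, hy]

theorem Tensor.contractRight_map (f : M →ₗ[R] R) (g : I →ₗ[Rᵐᵒᵖ] J) (x : Tensor R I M) :
    Tensor.contractRight f (Tensor.map g LinearMap.id x) = g (Tensor.contractRight f x) := by
  induction x using Tensor.induction with
  | zero => simp only [map_zero]
  | tmul i m => simp
  | add x y hx hy => simp only [map_add, hx, hy]

/-- Tensors over a projective right module vanish as soon as all their contractions do. -/
theorem Tensor.eq_zero_of_contractLeft [Module.Projective Rᵐᵒᵖ I] {x : Tensor R I M}
    (hx : ∀ f : I →ₗ[Rᵐᵒᵖ] Rᵐᵒᵖ, Tensor.contractLeft f x = 0) : x = 0 := by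
  classical
  obtain ⟨s, hs⟩ := Module.projective_def'.1 (inferInstance : Module.Projective Rᵐᵒᵖ I)
  -- Dual basis expansion: the coordinates of the splitting `s` recover `x` from its contractions.
  -- Allowing every `T ⊇ S` gives two summands a common index set.
  have key : ∀ x : Tensor R I M, ∃ S : Finset I, ∀ T, S ⊆ T →
      x = ∑ q ∈ T, Tensor.tmul q (Tensor.contractLeft (Finsupp.lapply q ∘ₗ s) x) := by
    intro x
    induction x using Tensor.induction with
    | zero => exact ⟨∅, fun T _ => by simp [← Tensor.mk_apply]⟩
    | tmul i m =>
      refine ⟨(s i).support, fun T hT => ?_⟩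
      have hi : i = ∑ q ∈ T, s i q • q := by
        conv_lhs => rw [← LinearMap.id_apply (R := Rᵐᵒᵖ) i, ← hs]
        rw [LinearMap.comp_apply, Finsupp.linearCombination_apply, Finsupp.sum_of_support_subset _ hT]
        · rfl
        · simp
      conv_lhs => rw [hi]
      rw [← Tensor.mk_apply, map_sum, AddMonoidHom.finsetSum_apply]
      refine Finset.sum_congr rfl fun q _ => ?_
      exact Tensor.smul_tmul (s i q).unop q m
    | add x y hx hy =>
      obtain ⟨S, hS⟩ := hx
      obtain ⟨S', hS'⟩ := hy
      refine ⟨S ∪ S', fun T hT => ?_⟩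
      conv_lhs => rw [hS T (Finset.union_subset_left hT), hS' T (Finset.union_subset_right hT)]
      simp only [map_add, Tensor.tmul_add, Finset.sum_add_distrib]
  obtain ⟨S, hS⟩ := key x
  rw [hS S subset_rfl]
  refine Finset.sum_eq_zero fun q _ => ?_
  rw [hx, ← Tensor.mk_apply, map_zero]

/-- Tensors over a projective left module vanish as soon as all their contractions do. -/
theorem Tensor.eq_zero_of_contractRight [Module.Projective R M] {x : Tensor R I M}
    (hx : ∀ f : M →ₗ[R] R, Tensor.contractRight f x = 0) : x = 0 := by
  classical
  obtain ⟨s, hs⟩ := Module.projective_def'.1 (inferInstance : Module.Projective R M)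
  have key : ∀ x : Tensor R I M, ∃ S : Finset M, ∀ T, S ⊆ T →
      x = ∑ q ∈ T, Tensor.tmul (Tensor.contractRight (Finsupp.lapply q ∘ₗ s) x) q := by
    intro x
    induction x using Tensor.induction with
    | zero => exact ⟨∅, fun T _ => by simp [← Tensor.mk_apply]⟩
    | tmul i m =>
      refine ⟨(s m).support, fun T hT => ?_⟩
      have hm : m = ∑ q ∈ T, s m q • q := by
        conv_lhs => rw [← LinearMap.id_apply (R := R) m, ← hs]
        rw [LinearMap.comp_apply, Finsupp.linearCombination_apply, Finsupp.sum_of_support_subset _ hT]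
        · rfl
        · simp
      conv_lhs => rw [hm]
      rw [← Tensor.mk_apply, map_sum]
      refine Finset.sum_congr rfl fun q _ => ?_
      exact (Tensor.smul_tmul (s m q) i q).symm
    | add x y hx hy =>
      obtain ⟨S, hS⟩ := hx
      obtain ⟨S', hS'⟩ := hy
      refine ⟨S ∪ S', fun T hT => ?_⟩
      conv_lhs => rw [hS T (Finset.union_subset_left hT), hS' T (Finset.union_subset_right hT)]
      simp only [map_add, Tensor.add_tmul, Finset.sum_add_distrib]
  obtain ⟨S, hS⟩ := key x
  rw [hS S subset_rfl]
  refine Finset.sum_eq_zero fun q _ => ?_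
  rw [hx, ← Tensor.mk_apply, map_zero, AddMonoidHom.zero_apply]

/-- Tensoring with a projective right module preserves injections. -/
theorem Tensor.map_id_left_injective [Module.Projective Rᵐᵒᵖ I] {g : M →ₗ[R] N}
    (hg : Function.Injective g) :
    Function.Injective (Tensor.map (LinearMap.id : I →ₗ[Rᵐᵒᵖ] I) g) := by
  refine (injective_iff_map_eq_zero _).2 fun x hx => Tensor.eq_zero_of_contractLeft fun f => hg ?_
  rw [← Tensor.contractLeft_map, hx, map_zero, map_zero]

/-- Tensoring with a projective left module preserves injections. -/
theorem Tensor.map_id_right_injective [Module.Projective R M] {f : I →ₗ[Rᵐᵒᵖ] J}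
    (hf : Function.Injective f) :
    Function.Injective (Tensor.map f (LinearMap.id : M →ₗ[R] M)) := by
  refine (injective_iff_map_eq_zero _).2 fun x hx => Tensor.eq_zero_of_contractRight fun g => hf ?_
  rw [← Tensor.contractRight_map, hx, map_zero, map_zero]

end TensorFacts

/-! ### Flat modules in short exact sequences. -/

section Flat

variable {R : Type u} [Ring R]

/-- A short exact sequence of left modules with flat cokernel stays exact under any tensor
product. -/
theorem IsFlat.map_injective [Small.{v} R] {A B C : ModuleCat.{v} R} (hC : IsFlat C)
    {f : A →ₗ[R] B} {g : B →ₗ[R] C} (hf : Function.Injective f) (hfg : Function.Exact f g)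
    (hg : Function.Surjective g) (I : ModuleCat.{v} Rᵐᵒᵖ) :
    Function.Injective (Tensor.map (LinearMap.id : I →ₗ[Rᵐᵒᵖ] I) f) := by
  have : Small.{v} Rᵐᵒᵖ := small_map MulOpposite.opEquiv.symm
  -- A presentation `0 → L → Q → I → 0` with `Q` projective replaces Tor: the rest is a chase in its
  -- tensor product with `0 → A → B → C → 0`.
  let Q : ModuleCat.{v} Rᵐᵒᵖ := Projective.over I
  let p : Q →ₗ[Rᵐᵒᵖ] I := (Projective.π I).hom
  have hp : Function.Surjective p := (ModuleCat.epi_iff_surjective (Projective.π I)).1 inferInstance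
  have : Module.Projective Rᵐᵒᵖ Q := (IsProjective.iff_projective Q).2
    (inferInstanceAs (Projective (Projective.over I)))
  let L : ModuleCat.{v} Rᵐᵒᵖ := ModuleCat.of Rᵐᵒᵖ (LinearMap.ker p)
  let k : L →ₗ[Rᵐᵒᵖ] Q := (LinearMap.ker p).subtype
  have hk : Function.Injective k := Subtype.val_injective
  have hkp : Function.Exact k p := LinearMap.exact_subtype_ker_map p
  refine (injective_iff_map_eq_zero _).2 fun x hx => ?_
  obtain ⟨y, rfl⟩ := Tensor.map_surjective hp (g := LinearMap.id) Function.surjective_id x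
  have hy : Tensor.map p LinearMap.id (Tensor.map (LinearMap.id : Q →ₗ[Rᵐᵒᵖ] Q) f y) = 0 := by
    rw [Tensor.map_map] at hx ⊢
    exact hx
  obtain ⟨l, hl⟩ := (Tensor.exact_map_left hkp hp _).1 hy
  -- Flatness of `C` enters here: `L ⊗ C → Q ⊗ C` is injective.
  have hl0 : Tensor.map (LinearMap.id : L →ₗ[Rᵐᵒᵖ] L) g l = 0 := by
    refine (injective_iff_map_eq_zero _).1 (hC L Q k hk) _ ?_
    have h0 : Tensor.map (LinearMap.id : Q →ₗ[Rᵐᵒᵖ] Q) g (Tensor.map k LinearMap.id l) = 0 := by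
      rw [hl]
      exact (Tensor.exact_map_right hfg hg _).2 ⟨y, rfl⟩
    rw [Tensor.map_map] at h0 ⊢
    exact h0
  obtain ⟨a, rfl⟩ := (Tensor.exact_map_right hfg hg _).1 hl0
  have hya : Tensor.map k LinearMap.id a = y := by
    refine Tensor.map_id_left_injective (I := Q) hf ?_
    rw [← hl, Tensor.map_map, Tensor.map_map]
    rfl
  rw [← hya]
  exact (Tensor.exact_map_left hkp hp _).2 ⟨a, rfl⟩

/-- A flat kernel: if `0 → A → B → C → 0` is exact with `B` and `C` flat, then `A` is flat. -/
theorem IsFlat.of_shortExact [Small.{v} R] {A B C : ModuleCat.{v} R} (hB : IsFlat B)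
    (hC : IsFlat C) {f : A →ₗ[R] B} {g : B →ₗ[R] C} (hf : Function.Injective f)
    (hfg : Function.Exact f g) (hg : Function.Surjective g) : IsFlat A := by
  intro I J k hk
  -- The other way round the commutative square, this composite begins with `k ⊗ A`, which is
  -- therefore injective.
  have h : Function.Injective (Tensor.map k (LinearMap.id : B →ₗ[R] B) ∘
      Tensor.map (LinearMap.id : I →ₗ[Rᵐᵒᵖ] I) f) :=
    (hB I J k hk).comp (hC.map_injective hf hfg hg I)
  refine Function.Injective.of_comp (f := Tensor.map (LinearMap.id : J →ₗ[Rᵐᵒᵖ] J) f) ?_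
  convert h using 1
  ext x
  simp only [Function.comp_apply, Tensor.map_map]
  rfl

theorem isFlat_of_projective (P : ModuleCat.{v} R) [Module.Projective R P] : IsFlat P :=
  fun _ _ _ hf => Tensor.map_id_right_injective hf

end Flat

/-! ### Disk complexes, cycles and splicing in an abelian category. -/

section Complexes

open Limits

variable {A : Type*} [Category* A] [Abelian A]

/-- The direct sum over `j` of the contractible complexes `Q (j + 1) = Q (j + 1)` concentrated in
degrees `j + 1` and `j`. -/
noncomputable def diskSum (Q : ℤ → A) : ChainComplex A ℤ where
  X j := Q j ⊞ Q (j + 1)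
  d i j := if h : j + 1 = i then biprod.fst ≫ eqToHom (by rw [h]) ≫ biprod.inr else 0
  shape _ _ h := dif_neg h
  d_comp_d' := by
    rintro _ _ k rfl rfl
    simp

theorem diskSum_d (Q : ℤ → A) (j : ℤ) :
    (diskSum Q).d (j + 1) j = (biprod.fst ≫ biprod.inr : Q (j + 1) ⊞ Q (j + 1 + 1) ⟶ _) := by
  simp [diskSum]

/-- The chain map from a sum of disks given by morphisms in each degree. -/
noncomputable def diskSumDesc {Q : ℤ → A} {X : ChainComplex A ℤ} (π : ∀ j, Q j ⟶ X.X j) :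
    diskSum Q ⟶ X where
  f j := (biprod.desc (π j) (π (j + 1) ≫ X.d (j + 1) j) : Q j ⊞ Q (j + 1) ⟶ X.X j)
  comm' := by
    rintro _ j rfl
    rw [diskSum_d]
    have h : biprod.desc (π (j + 1)) (π (j + 1 + 1) ≫ X.d (j + 1 + 1) (j + 1)) ≫ X.d (j + 1) j =
        (biprod.fst ≫ (biprod.inr : Q (j + 1) ⟶ Q j ⊞ Q (j + 1))) ≫
          biprod.desc (π j) (π (j + 1) ≫ X.d (j + 1) j) := by
      apply biprod.hom_ext' <;> simp
    exact h

instance {Q : ℤ → A} {X : ChainComplex A ℤ} (π : ∀ j, Q j ⟶ X.X j) [∀ j, Epi (π j)] :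
    Epi (diskSumDesc π) := by
  have (j : ℤ) : Epi ((diskSumDesc π).f j) := by
    have h : biprod.inl ≫ (diskSumDesc π).f j = π j := biprod.inl_desc _ _
    have : Epi ((biprod.inl : Q j ⟶ Q j ⊞ Q (j + 1)) ≫ (diskSumDesc π).f j) := by
      rw [h]
      infer_instance
    exact epi_of_epi (biprod.inl : Q j ⟶ Q j ⊞ Q (j + 1)) _
  exact HomologicalComplex.epi_of_epi_f _ inferInstance

/-- A sum of disks is contractible. -/
noncomputable def diskSumContraction (Q : ℤ → A) : Homotopy (𝟙 (diskSum Q)) 0 where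
  -- The differential identifies the first summand in degree `i + 1` with the second in degree `i`;
  -- the contraction inverts this.
  hom i j := if h : i + 1 = j then
    (biprod.snd ≫ eqToHom (by rw [h]) ≫ biprod.inl : Q i ⊞ Q (i + 1) ⟶ Q j ⊞ Q (j + 1)) else 0
  zero _ _ h := dif_neg h
  comm i := by
    obtain ⟨k, rfl⟩ : ∃ k, i = k + 1 := ⟨i - 1, by ring⟩
    rw [dNext_eq _ (show (ComplexShape.down ℤ).Rel (k + 1) k from rfl),
      prevD_eq _ (show (ComplexShape.down ℤ).Rel (k + 1 + 1) (k + 1) from rfl), diskSum_d,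
      diskSum_d]
    have h : 𝟙 (Q (k + 1) ⊞ Q (k + 1 + 1)) =
        (biprod.fst ≫ (biprod.inr : _ ⟶ Q k ⊞ Q (k + 1))) ≫ biprod.snd ≫ biprod.inl +
          (biprod.snd ≫ (biprod.inl : _ ⟶ Q (k + 1 + 1) ⊞ Q (k + 1 + 1 + 1))) ≫
            biprod.fst ≫ biprod.inr + 0 := by
      simp
    simp only [↓reduceDIte, eqToHom_refl, Category.id_comp]
    exact h

theorem acyclic_of_contraction {ι : Type*} {c : ComplexShape ι} {X : HomologicalComplex A c}
    (h : Homotopy (𝟙 X) 0) : X.Acyclic := fun i => by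
  rw [HomologicalComplex.exactAt_iff_isZero_homology, IsZero.iff_id_eq_zero,
    ← HomologicalComplex.homologyMap_id, h.homologyMap_eq, HomologicalComplex.homologyMap_zero]

/-- Any map between acyclic complexes is a quasi-isomorphism, so its kernel, when it is epi, is
acyclic. -/
theorem acyclic_X₁ {S : ShortComplex (ChainComplex A ℤ)} (hS : S.ShortExact)
    (h₂ : S.X₂.Acyclic) (h₃ : S.X₃.Acyclic) : S.X₁.Acyclic := by
  refine hS.acyclic_X₁ ⟨fun i => ?_⟩
  rw [quasiIsoAt_iff_exactAt _ _ (h₂ i)]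
  exact h₃ i

/-- Cycles of a short exact sequence of acyclic complexes form a short exact sequence. -/
theorem cycles_shortExact {S : ShortComplex (ChainComplex A ℤ)} (hS : S.ShortExact)
    (h₃ : S.X₃.Acyclic) (j : ℤ) :
    (S.map (HomologicalComplex.cyclesFunctor A (ComplexShape.down ℤ) j)).ShortExact := by
  have := hS.mono_f
  have := hS.epi_g
  refine ShortComplex.ShortExact.mk' (HomologicalComplex.cycles_left_exact S
    hS.exact j) ?_ ?_
  · exact inferInstanceAs (Mono (HomologicalComplex.cyclesMap S.f j))
  -- Cycles of `X₃` are boundaries, so they lift through degree `j + 1`, where `S.g` is epi.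
  · have h : Epi (S.X₃.toCycles (j + 1) j) :=
      Preadditive.epi_of_isZero_cokernel' _ (S.X₃.homologyIsCokernel (j + 1) j (by simp))
        ((HomologicalComplex.exactAt_iff_isZero_homology _ _).1 (h₃ j))
    have h' : S.X₂.toCycles (j + 1) j ≫ HomologicalComplex.cyclesMap S.g j =
        S.g.f (j + 1) ≫ S.X₃.toCycles (j + 1) j := by
      simp [← cancel_mono (S.X₃.iCycles j)]
    have : Epi (S.X₂.toCycles (j + 1) j ≫ HomologicalComplex.cyclesMap S.g j) := by
      rw [h']
      infer_instance
    exact epi_of_epi (S.X₂.toCycles (j + 1) j) (HomologicalComplex.cyclesMap S.g j)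

/-- The complex `⋯ → E₂ → E₁ → P → M` obtained by splicing `⋯ → E₂ → E₁ → E₀` and
`E₀ → P → M`. -/
noncomputable def splice (E : ChainComplex A ℕ) {P M : A} (f : E.X 0 ⟶ P) (g : P ⟶ M)
    (w : f ≫ g = 0) : ChainComplex A ℕ :=
  ((ChainComplex.truncate.obj E).augment (E.d 1 0 ≫ f) (by
    change E.d 2 1 ≫ E.d 1 0 ≫ f = 0
    rw [E.d_comp_d_assoc, zero_comp])).augment g (by
    change (E.d 1 0 ≫ f) ≫ g = 0
    rw [Category.assoc, w, comp_zero])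

/-- Exactness in degrees 0 and 1 comes from `S`, as `E.d 1 0` is epi; in degree 2 it comes from `E`,
as `S.f` is mono; above that the complex is `E` shifted by one. -/
theorem splice_acyclic {E : ChainComplex A ℕ} (hE : E.Acyclic) {S : ShortComplex A}
    (hS : S.ShortExact) (e : E.X 0 ≅ S.X₁) :
    (splice E (e.hom ≫ S.f) S.g (by simp)).Acyclic := by
  have := hS.mono_f
  have := hS.epi_g
  rintro (_ | _ | _ | i)
  · rw [HomologicalComplex.exactAt_iff' _ 1 0 0 (by simp) (by simp)]
    exact (ShortComplex.exact_iff_epi _ rfl).2 hS.epi_g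
  · rw [HomologicalComplex.exactAt_iff' _ 2 1 0 (by simp) (by simp)]
    have h0 := (HomologicalComplex.exactAt_iff' _ 1 0 0 (by simp) (by simp)).1 (hE 0)
    have : Epi (E.d 1 0) :=
      (ShortComplex.exact_iff_epi _ (HomologicalComplex.shape _ _ _ (by simp))).1 h0
    have : Epi (E.d 1 0 ≫ e.hom) := inferInstance
    let φ : (splice E (e.hom ≫ S.f) S.g (by simp)).sc' 2 1 0 ⟶ S :=
      { τ₁ := E.d 1 0 ≫ e.hom
        τ₂ := 𝟙 S.X₂
        τ₃ := 𝟙 S.X₃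
        comm₁₂ := ((Category.assoc _ _ _).trans (Category.comp_id _).symm)
        comm₂₃ := ((Category.id_comp _).trans (Category.comp_id _).symm) }
    have : Epi φ.τ₁ := this
    have : IsIso φ.τ₂ := inferInstanceAs (IsIso (𝟙 S.X₂))
    have : Mono φ.τ₃ := inferInstanceAs (Mono (𝟙 S.X₃))
    exact (ShortComplex.exact_iff_of_epi_of_isIso_of_mono φ).2 hS.exact
  · rw [HomologicalComplex.exactAt_iff' _ 3 2 1 (by simp) (by simp)]
    have h1 := (HomologicalComplex.exactAt_iff' _ 2 1 0 (by simp) (by simp)).1 (hE 1)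
    let φ : E.sc' 2 1 0 ⟶ (splice E (e.hom ≫ S.f) S.g (by simp)).sc' 3 2 1 :=
      { τ₁ := 𝟙 (E.X 2)
        τ₂ := 𝟙 (E.X 1)
        τ₃ := e.hom ≫ S.f
        comm₁₂ := ((Category.id_comp _).trans (Category.comp_id _).symm)
        comm₂₃ := Category.id_comp _ }
    have : Epi φ.τ₁ := inferInstanceAs (Epi (𝟙 (E.X 2)))
    have : IsIso φ.τ₂ := inferInstanceAs (IsIso (𝟙 (E.X 1)))
    have : Mono φ.τ₃ := inferInstanceAs (Mono (e.hom ≫ S.f))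
    exact (ShortComplex.exact_iff_of_epi_of_isIso_of_mono φ).1 h1
  · rw [HomologicalComplex.exactAt_iff' _ (i + 4) (i + 3) (i + 2) (by simp) (by simp)]
    exact (HomologicalComplex.exactAt_iff' _ (i + 3) (i + 2) (i + 1) (by simp) (by simp)).1
      (hE (i + 2))

end Complexes

/-! ### PGF resolutions and the dimension shift. -/

section Resolutions

open Limits

variable {R : Type u} [Ring R]

theorem IsPGF.of_iso {M N : ModuleCat.{v} R} (hM : IsPGF M) (e : N ≅ M) : IsPGF N := by
  obtain ⟨X, h₁, h₂, h₃, j, ⟨i⟩⟩ := hM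
  exact ⟨X, h₁, h₂, h₃, j, ⟨e ≪≫ i⟩⟩

theorem IsPGF.hasPGFResolution_zero {M : ModuleCat.{v} R} (hM : IsPGF M) :
    HasPGFResolution M 0 := by
  have hE : (HomologicalComplex.zero : ChainComplex (ModuleCat.{v} R) ℕ).Acyclic :=
    acyclic_of_contraction (Homotopy.ofEq (HomologicalComplex.isZero_zero.eq_of_src _ _))
  have hz (i : ℕ) : IsZero ((HomologicalComplex.zero : ChainComplex (ModuleCat.{v} R) ℕ).X i) :=
    Functor.map_isZero (HomologicalComplex.eval _ (ComplexShape.down ℕ) i) HomologicalComplex.isZero_zero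
  -- The resolution is the zero complex spliced with `0 → 0 → M → M → 0`.
  let S : ShortComplex (ModuleCat.{v} R) := ShortComplex.mk
    (0 : (HomologicalComplex.zero : ChainComplex (ModuleCat.{v} R) ℕ).X 0 ⟶ M) (𝟙 M) (by simp)
  have hS : S.ShortExact :=
    { exact := (ShortComplex.exact_iff_mono _ rfl).2 (inferInstanceAs (Mono (𝟙 M)))
      mono_f := (hz 0).mono _
      epi_g := inferInstanceAs (Epi (𝟙 M)) }
  refine ⟨_, splice_acyclic hE hS (Iso.refl _), ⟨Iso.refl M⟩, ?_, ?_⟩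
  · intro i hi
    obtain rfl : i = 0 := by lia
    exact hM
  · rintro (_ | i) hi
    · lia
    · exact hz (i + 1)

theorem HasPGFResolution.of_iso {M N : ModuleCat.{v} R} {n : ℕ} (hM : HasPGFResolution M n)
    (e : M ≅ N) : HasPGFResolution N n := by
  obtain ⟨E, hE, ⟨i⟩, h, h'⟩ := hM
  exact ⟨E, hE, ⟨i ≪≫ e⟩, h, h'⟩

/-- Resolutions can be extended along short exact sequences whose middle term is in PGF. -/
theorem HasPGFResolution.succ {S : ShortComplex (ModuleCat.{v} R)} (hS : S.ShortExact)
    (h₂ : IsPGF S.X₂) {n : ℕ} (h₁ : HasPGFResolution S.X₁ n) : HasPGFResolution S.X₃ (n + 1) := by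
  obtain ⟨E, hE, ⟨e⟩, h, h'⟩ := h₁
  refine ⟨_, splice_acyclic hE hS e, ⟨Iso.refl _⟩, ?_, ?_⟩
  · rintro (_ | i) hi
    · exact h₂
    · exact h i (by lia)
  · rintro (_ | i) hi
    · lia
    · exact h' i (by lia)

/-- Additive functors preserve contractions. -/
theorem injTensorAcyclic_diskSum (Q : ℤ → ModuleCat.{v} R) : InjTensorAcyclic (diskSum Q) :=
  fun I _ => by
    have h := (tensorLeft (R := R) I).mapHomotopy (diskSumContraction Q)
    rw [CategoryTheory.Functor.map_id, Functor.map_zero] at h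
    exact acyclic_of_contraction h

variable [Small.{v} R]

/-- Tensoring a short exact sequence with flat cokernel gives a short exact sequence. -/
theorem IsFlat.map_shortExact {S : ShortComplex (ModuleCat.{v} R)} (hS : S.ShortExact)
    (h₃ : IsFlat S.X₃) (I : ModuleCat.{v} Rᵐᵒᵖ) : (S.map (tensorLeft I)).ShortExact := by
  have hf := hS.moduleCat_injective_f
  have hg := hS.moduleCat_surjective_g
  have hfg := (ShortComplex.ShortExact.moduleCat_exact_iff_function_exact S).1 hS.exact
  refine ShortComplex.ShortExact.mk' ?_ ?_ ?_
  · rw [ShortComplex.ab_exact_iff_function_exact]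
    exact Tensor.exact_map_right hfg hg
  · rw [AddCommGrpCat.mono_iff_injective]
    exact h₃.map_injective hf hfg hg I
  · rw [AddCommGrpCat.epi_iff_surjective]
    exact Tensor.map_surjective Function.surjective_id hg

theorem InjTensorAcyclic.X₁ {S : ShortComplex (ChainComplex (ModuleCat.{v} R) ℤ)}
    (hS : S.ShortExact) (h₂ : InjTensorAcyclic S.X₂) (h₃ : InjTensorAcyclic S.X₃)
    (hf : ∀ j, IsFlat (S.X₃.X j)) : InjTensorAcyclic S.X₁ := fun I hI => by
  let T := S.map ((tensorLeft (R := R) I).mapHomologicalComplex (ComplexShape.down ℤ))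
  have hT : T.ShortExact :=
    HomologicalComplex.shortExact_of_degreewise_shortExact T fun j =>
      IsFlat.map_shortExact ((HomologicalComplex.shortExact_iff_degreewise_shortExact S).1 hS j)
        (hf j) I
  exact acyclic_X₁ hT (h₂ I hI) (h₃ I hI)

/-- Cycles of an F-totally acyclic complex whose terms have projective dimension at most `n` have
a PGF resolution of length `n`. -/
theorem IsFTotallyAcyclic.hasPGFResolution_cycles {n : ℕ}
    {X : ChainComplex (ModuleCat.{v} R) ℤ} (hX : IsFTotallyAcyclic X)
    (hn : ∀ j, HasProjectiveDimensionLE (X.X j) n) (j : ℤ) : HasPGFResolution (X.cycles j) n := by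
  -- The inductive step applies to a new complex, the kernel of a disk cover.
  induction n generalizing X with
  | zero =>
    refine IsPGF.hasPGFResolution_zero ⟨X, hX.acyclic, fun i => ?_, hX.tensor, j, ⟨Iso.refl _⟩⟩
    exact (IsProjective.iff_projective (X.X i)).2
      ((projective_iff_hasProjectiveDimensionLE_zero _).2 (hn i))
  | succ n ih =>
    let Q (i : ℤ) : ModuleCat.{v} R := Projective.over (X.X i)
    let φ : diskSum Q ⟶ X := diskSumDesc fun i => Projective.π (X.X i)
    let S := ShortComplex.mk (kernel.ι φ) φ (kernel.condition φ)
    have hS : S.ShortExact := ShortComplex.ShortExact.mk' (ShortComplex.exact_kernel φ)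
      (inferInstanceAs (Mono (kernel.ι φ))) (inferInstanceAs (Epi (diskSumDesc _)))
    have hSj := (HomologicalComplex.shortExact_iff_degreewise_shortExact S).1 hS
    have hP (i : ℤ) : Projective ((diskSum Q).X i) := inferInstanceAs (Projective (Q i ⊞ Q (i + 1)))
    have hP' (i : ℤ) : Module.Projective R ((diskSum Q).X i) :=
      (IsProjective.iff_projective ((diskSum Q).X i)).2 (hP i)
    have hacyc : (diskSum Q).Acyclic := acyclic_of_contraction (diskSumContraction Q)
    have hK : IsFTotallyAcyclic (kernel φ) :=
      { acyclic := acyclic_X₁ hS hacyc hX.acyclic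
        flat i := IsFlat.of_shortExact (isFlat_of_projective ((diskSum Q).X i)) (hX.flat i)
          (hSj i).moduleCat_injective_f
          ((ShortComplex.ShortExact.moduleCat_exact_iff_function_exact _).1 (hSj i).exact)
          (hSj i).moduleCat_surjective_g
        tensor := InjTensorAcyclic.X₁ hS (injTensorAcyclic_diskSum Q) hX.tensor hX.flat }
    refine HasPGFResolution.succ (cycles_shortExact hS hX.acyclic j) ?_ (ih hK fun i => ?_)
    · exact ⟨diskSum Q, hacyc, hP', injTensorAcyclic_diskSum Q, j, ⟨Iso.refl _⟩⟩
    -- The middle term is projective, so the bound `n + 1` on the quotient drops to `n` on the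
    -- kernel.
    · exact ((hSj i).hasProjectiveDimensionLT_X₃_iff n (hP i)).1 (hn i)

end Resolutions

end PGF

theorem lemma11 {R : Type u} [Ring R] [Small.{v} R] (n : ℕ)
    (hR : PGF.IsLeftNPerfect.{u, v} R n) (G : ModuleCat.{v} R) (hG : PGF.IsGorensteinFlat G) :
    PGF.pgfDimension G ≤ (n : ℕ∞) := by
  obtain ⟨X, hX, j, ⟨e⟩⟩ := hG
  have h := (hX.hasPGFResolution_cycles (fun i => hR _ (hX.flat i)) j).of_iso e.symm
  exact iInf₂_le n h
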